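/- Let $m\ge 2$ and let $G$ be the $2\times m$ cylinder graph, whose $2m$ nodes are arranged in two rows and $m$ columns: each row is a cycle through the $m$ columns in cyclic order (a single edge if $m=2$), the two nodes of every column are adjacent, and there are no other edges. Let $N$ be a set of $n\ge 2$ agents partitioned into $k\ge 2$ non-empty types, with $n<2m$. An assignment places the agents at pairwise different nodes of $G$; a node that holds no agent is empty. The utility of an agent in an assignment is the number of types, different from its own, that occur among the agents at nodes adjacent to its node. An assignment is an equilibrium if no agent can strictly increase its utility by jumping to an empty node while all other agents stay in place. Then, for every such $m$, $N$ and partition into types, there exists an equilibrium assignment. -/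

import Mathlib

namespace VarietyJumpGame

variable {N T V : Type*}

/-- The neighbors of agent `i` under the assignment `v`: the agents that occupy nodes
adjacent to the node of `i` in `G`. -/
def neighbors (G : SimpleGraph V) (v : N → V) (i : N) : Set N :=
  {j | G.Adj (v i) (v j)}

/-- The utility of agent `i` under the assignment `v`: the number of types different from its
own type `t i` that are present among its neighbors. -/
noncomputable def utility (G : SimpleGraph V) (t : N → T) (v : N → V) (i : N) : ℕ :=
  ((t '' neighbors G v i) \ {t i}).ncard

/-- An assignment places different agents at different nodes. -/
def IsAssignment (v : N → V) : Prop := Function.Injective v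

/-- A node is empty under `v` if no agent occupies it. -/
def IsEmptyNode (v : N → V) (w : V) : Prop := ∀ j, v j ≠ w

open Classical in
/-- The placement obtained from `v` when agent `i` jumps to node `w` and all others stay. -/
noncomputable def jump (v : N → V) (i : N) (w : V) : N → V := Function.update v i w

/-- A pure Nash equilibrium: an assignment in which no agent can strictly increase its utility
by unilaterally jumping to an empty node. -/
def IsEquilibrium (G : SimpleGraph V) (t : N → T) (v : N → V) : Prop :=
  IsAssignment v ∧
    ∀ (i : N) (w : V), IsEmptyNode v w → utility G t (jump v i w) i ≤ utility G t v i

/-- The `2 × m` cylinder graph: two rows, each of which is a cycle through the `m` columns, and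
an edge between the two nodes of each column. -/
def cylinderGraph (m : ℕ) : SimpleGraph (Fin 2 × Fin m) :=
  (SimpleGraph.pathGraph 2).boxProd (SimpleGraph.cycleGraph m)

end VarietyJumpGame

/-!
Number the nodes of the cylinder column by column, so that `2 * c + r` is the node in row `r` and
column `c`, and let `n` be the number of agents.

If there are two types, or if all types are singletons, then an improving jump always raises the
number of neighbors of another type of the jumping agent. Hence the number of edges between agents
of different types is a potential, and an assignment that maximizes it is an equilibrium
(`exists_isEquilibrium_of_bichromaticDegree_lt`).

Otherwise there are at least three types and a largest type `A` has at least two agents. The agents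
occupy the positions `0, …, n - 1`. The point is that empty nodes then have occupied neighbors only
among the four corners `0`, `1`, `n - 2`, `n - 1` (`LadderAdj.of_empty`), so that an equilibrium
results from controlling the types at the corners and giving every other agent a neighbor of
another type, or two such neighbors of different types. The agents are arranged as follows.

* If `A` has at least four agents, it takes all corners. Then only agents of other types may gain by
  jumping, and at most one, so it suffices that each of them has a neighbor of another type. The
  positions next to corners are safe, and elsewhere the two agents of each column get different
  types, or both type `A` (`exists_isStable_of_four_le`).
* If no type has more than three agents, an agent with three neighbors always has one of another
  type. For even `n` and two types `A`, `B` that are not singletons, `A` takes the corners in one row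
  and `B` those in the other, so that each empty node sees one type only. If only `A` is not a
  singleton, then `A` takes the last two positions, and position `0` if it has a third agent.
* For odd `n`, the last two positions both border on the empty node in the last, half-filled column
  and get type `A`. A third agent of type `A` goes to position `1` if there is one empty node, and to
  position `0` otherwise. If there is no type with three agents, then equal types are put on
  diagonals, so that every agent away from the ends has neighbors of two other types.
-/

namespace VarietyJumpGame

/-! ### Bichromatic edges as a potential -/

open Classical in
/-- The number of agents next to agent `i` whose type differs from that of `i`. -/
noncomputable def bichromaticDegree {N T V : Type*} [Fintype N] (G : SimpleGraph V) (t : N → T)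
    (v : N → V) (i : N) : ℕ :=
  ∑ j, if G.Adj (v i) (v j) ∧ t i ≠ t j then 1 else 0

section Potential

variable {N T V : Type*} (G : SimpleGraph V) (t : N → T)

theorem bichromaticDegree_eq_card [Fintype N] (v : N → V) (i : N) :
    bichromaticDegree G t v i = {j | G.Adj (v i) (v j) ∧ t i ≠ t j}.ncard := by
  classical
  rw [bichromaticDegree, Finset.sum_boole, Set.ncard_eq_toFinset_card']
  simp

theorem utility_eq_ncard_image (v : N → V) (i : N) :
    utility G t v i = (t '' {j | G.Adj (v i) (v j) ∧ t i ≠ t j}).ncard := by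
  rw [utility]
  congr 1
  ext X
  simp only [neighbors, Set.mem_sdiff, Set.mem_image, Set.mem_ofPred_eq, Set.mem_singleton_iff]
  constructor
  · rintro ⟨⟨j, hj, rfl⟩, h⟩
    exact ⟨j, ⟨hj, fun h' => h h'.symm⟩, rfl⟩
  · rintro ⟨j, ⟨hj, h⟩, rfl⟩
    exact ⟨⟨j, hj, rfl⟩, fun h' => h h'.symm⟩

theorem utility_le_bichromaticDegree [Fintype N] (v : N → V) (i : N) :
    utility G t v i ≤ bichromaticDegree G t v i := by
  rw [bichromaticDegree_eq_card, utility_eq_ncard_image]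
  exact Set.ncard_image_le (Set.toFinite _)

theorem bichromaticDegree_eq_zero_of_utility_eq_zero [Fintype N] (v : N → V) (i : N)
    (h : utility G t v i = 0) : bichromaticDegree G t v i = 0 := by
  rw [bichromaticDegree_eq_card]
  rw [utility_eq_ncard_image, Set.ncard_eq_zero (Set.toFinite _), Set.image_eq_empty] at h
  rw [h, Set.ncard_empty]

theorem utility_eq_bichromaticDegree_of_injective [Fintype N] (ht : Function.Injective t) (v : N → V)
    (i : N) : utility G t v i = bichromaticDegree G t v i := by
  rw [bichromaticDegree_eq_card, utility_eq_ncard_image, Set.ncard_image_of_injective _ ht]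

theorem utility_le_one_of_card_eq_two [Fintype T] (hT : Fintype.card T = 2) (v : N → V)
    (i : N) : utility G t v i ≤ 1 := by
  classical
  have h : (Set.univ \ {t i} : Set T).ncard = 1 := by
    rw [Set.ncard_sdiff_singleton_of_mem (Set.mem_univ _), Set.ncard_univ,
      Nat.card_eq_fintype_card, hT]
  rw [← h]
  exact Set.ncard_le_ncard (Set.sdiff_subset_sdiff_left (Set.subset_univ _)) (Set.toFinite _)

/-- The terms of a symmetric double sum that involve the index `i` are twice row `i`. -/
theorem sum_sum_eq_two_mul_add_of_symm [Fintype N] [DecidableEq N] (F : N → N → ℕ)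
    (hs : ∀ i j, F i j = F j i) (h0 : ∀ i, F i i = 0) (i : N) :
    ∑ a, ∑ b, F a b =
      2 * ∑ b, F i b + ∑ a ∈ Finset.univ.erase i, ∑ b ∈ Finset.univ.erase i, F a b := by
  have row : ∀ a, ∑ b, F a b = F a i + ∑ b ∈ Finset.univ.erase i, F a b := fun a =>
    (Finset.add_sum_erase _ _ (Finset.mem_univ i)).symm
  rw [← Finset.add_sum_erase _ _ (Finset.mem_univ i),
    Finset.sum_congr rfl (fun a _ => row a), Finset.sum_add_distrib]
  have h1 : ∑ a ∈ Finset.univ.erase i, F a i = ∑ b, F i b := by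
    rw [row i, h0 i, zero_add]
    exact Finset.sum_congr rfl fun a _ => hs a i
  rw [h1]
  ring

/-- If every improving jump also raises the bichromatic degree of the jumping agent, then the
number of bichromatic edges is a potential, and its maximizers are equilibria. -/
theorem exists_isEquilibrium_of_bichromaticDegree_lt [Fintype N] [Fintype V]
    (hV : Fintype.card N ≤ Fintype.card V)
    (h : ∀ (v : N → V) (i : N) (w : V), utility G t v i < utility G t (jump v i w) i →
      bichromaticDegree G t v i < bichromaticDegree G t (jump v i w) i) :
    ∃ v : N → V, IsEquilibrium G t v := by
  classical
  obtain ⟨v₀⟩ := Function.Embedding.nonempty_of_card_le hV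
  obtain ⟨v, hv, hmax⟩ := Set.exists_max_image {v : N → V | Function.Injective v}
    (fun v => ∑ i, bichromaticDegree G t v i) (Set.toFinite _) ⟨v₀, v₀.injective⟩
  refine ⟨v, hv, fun i w hw => ?_⟩
  by_contra! hlt
  have hdeg := h v i w hlt
  have hinj : Function.Injective (jump v i w) := by
    intro a b hab
    unfold jump at hab
    by_cases ha : a = i <;> by_cases hb : b = i
    · rw [ha, hb]
    · subst ha
      rw [Function.update_self, Function.update_of_ne hb] at hab
      exact absurd hab.symm (hw b)
    · subst hb
      rw [Function.update_self, Function.update_of_ne ha] at hab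
      exact absurd hab (hw a)
    · rw [Function.update_of_ne ha, Function.update_of_ne hb] at hab
      exact hv hab
  have hle := hmax _ hinj
  have key : ∀ u : N → V, ∑ a, bichromaticDegree G t u a =
      2 * bichromaticDegree G t u i + ∑ a ∈ Finset.univ.erase i, ∑ b ∈ Finset.univ.erase i,
        if G.Adj (u a) (u b) ∧ t a ≠ t b then 1 else 0 := fun u =>
    sum_sum_eq_two_mul_add_of_symm
      (fun a b => if G.Adj (u a) (u b) ∧ t a ≠ t b then 1 else 0)
      (fun a b => by simp only [G.adj_comm (u a) (u b), ne_comm (a := t a)]) (fun a => by simp) i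
  rw [key, key] at hle
  -- the edges that avoid agent `i` are the same before and after the jump
  have hrest : ∑ a ∈ Finset.univ.erase i, ∑ b ∈ Finset.univ.erase i,
      (if G.Adj (jump v i w a) (jump v i w b) ∧ t a ≠ t b then 1 else 0) =
      ∑ a ∈ Finset.univ.erase i, ∑ b ∈ Finset.univ.erase i,
      (if G.Adj (v a) (v b) ∧ t a ≠ t b then 1 else 0) := by
    refine Finset.sum_congr rfl fun a ha => Finset.sum_congr rfl fun b hb => ?_
    rw [jump, Function.update_of_ne (Finset.ne_of_mem_erase ha),
      Function.update_of_ne (Finset.ne_of_mem_erase hb)]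
  omega

theorem exists_isEquilibrium_of_card_eq_two [Fintype N] [Fintype V] [Fintype T]
    (hT : Fintype.card T = 2) (hV : Fintype.card N ≤ Fintype.card V) :
    ∃ v : N → V, IsEquilibrium G t v := by
  refine exists_isEquilibrium_of_bichromaticDegree_lt G t hV fun v i w hlt => ?_
  have h1 := utility_le_one_of_card_eq_two G t hT (jump v i w) i
  have h2 := utility_le_bichromaticDegree G t (jump v i w) i
  have h3 := bichromaticDegree_eq_zero_of_utility_eq_zero G t v i (by omega)
  omega

theorem exists_isEquilibrium_of_injective [Fintype N] [Fintype V] (ht : Function.Injective t)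
    (hV : Fintype.card N ≤ Fintype.card V) : ∃ v : N → V, IsEquilibrium G t v := by
  refine exists_isEquilibrium_of_bichromaticDegree_lt G t hV fun v i w hlt => ?_
  rwa [← utility_eq_bichromaticDegree_of_injective G t ht,
    ← utility_eq_bichromaticDegree_of_injective G t ht]

end Potential

/-! ### Positions in the cylinder graph -/

section Ladder

/-- Adjacency in the cylinder graph in terms of the numbering of its nodes column by column:
node `2 * c + r` is the node in row `r` and column `c`. The last two disjuncts close the rows
to cycles. -/
def LadderAdj (m a b : ℕ) : Prop :=
  (a / 2 = b / 2 ∧ a ≠ b) ∨ a + 2 = b ∨ b + 2 = a ∨ a + 2 = b + 2 * m ∨ b + 2 = a + 2 * m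

theorem cylinderGraph_adj_iff {m : ℕ} (hm : 2 ≤ m) (x y : Fin 2 × Fin m) :
    (cylinderGraph m).Adj x y ↔ LadderAdj m (2 * x.2 + x.1) (2 * y.2 + y.1) := by
  obtain ⟨⟨r, hr⟩, ⟨c, hc⟩⟩ := x
  obtain ⟨⟨r', hr'⟩, ⟨c', hc'⟩⟩ := y
  simp only [cylinderGraph, SimpleGraph.boxProd_adj, SimpleGraph.pathGraph_adj,
    SimpleGraph.cycleGraph_adj', Fin.mk.injEq, LadderAdj, Fin.sub_def]
  have h1 : (m - c' + c) % m = if c' ≤ c then c - c' else m + c - c' := by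
    split_ifs with h
    · rw [show m - c' + c = (c - c') + m by omega, Nat.add_mod_right, Nat.mod_eq_of_lt (by omega)]
    · rw [Nat.mod_eq_of_lt (by omega)]; omega
  have h2 : (m - c + c') % m = if c ≤ c' then c' - c else m + c' - c := by
    split_ifs with h
    · rw [show m - c + c' = (c' - c) + m by omega, Nat.add_mod_right, Nat.mod_eq_of_lt (by omega)]
    · rw [Nat.mod_eq_of_lt (by omega)]; omega
  rw [h1, h2]
  split_ifs <;> omega

variable {N T : Type*}

/-- The types other than `τ a` that an agent from position `a` sees when it stands at position
`q`; positions `b < n` hold an agent of type `τ b`, and the agent's own position counts as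
vacated. -/
def seen (m n : ℕ) (τ : ℕ → T) (a q : ℕ) : Set T :=
  {X | X ≠ τ a ∧ ∃ b < n, b ≠ a ∧ LadderAdj m q b ∧ τ b = X}

/-- If the agents are placed at the positions `0, …, n - 1`, with types `τ`, then no agent gains
by a jump. -/
def IsStable (m n : ℕ) (τ : ℕ → T) : Prop :=
  ∀ a < n, ∀ q, n ≤ q → q < 2 * m → (seen m n τ a q).ncard ≤ (seen m n τ a a).ncard

theorem exists_isEquilibrium_of_isStable {m n : ℕ} (hm : 2 ≤ m) (hn : n ≤ 2 * m) (t : N → T)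
    {f : ℕ → N} (hf : Set.BijOn f (Set.Iio n) Set.univ) (h : IsStable m n (t ∘ f)) :
    ∃ v : N → Fin 2 × Fin m, IsEquilibrium (cylinderGraph m) t v := by
  classical
  have hsurj : ∀ i, ∃ a, a < n ∧ f a = i := fun i => hf.surjOn (Set.mem_univ i)
  choose g hgn hgf using hsurj
  have hgi : ∀ a < n, g (f a) = a := fun a ha => hf.injOn (hgn _) ha (hgf _)
  have hg : Function.Injective g := fun i j hij => by rw [← hgf i, ← hgf j, hij]
  let v : N → Fin 2 × Fin m := fun i =>
    (⟨g i % 2, by omega⟩, ⟨g i / 2, by have := hgn i; omega⟩)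
  have hpos : ∀ i, 2 * ((v i).2 : ℕ) + (v i).1 = g i := fun i => Nat.div_add_mod _ _
  have hv : Function.Injective v := fun i j hij => hg (by rw [← hpos i, ← hpos j, hij])
  -- the types seen from a node, in terms of positions
  have hset : ∀ (i : N) (u : N → Fin 2 × Fin m) (w : Fin 2 × Fin m), u i = w →
      (∀ j, j ≠ i → u j = v j) →
      (t '' neighbors (cylinderGraph m) u i) \ {t i} =
        seen m n (t ∘ f) (g i) (2 * (w.2 : ℕ) + w.1) := by
    intro i u w hui huj
    ext X
    simp only [neighbors, seen, Set.mem_sdiff, Set.mem_image, Set.mem_ofPred_eq,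
      Set.mem_singleton_iff, Function.comp_apply, hgf]
    constructor
    · rintro ⟨⟨j, hj, rfl⟩, hX⟩
      have hji : j ≠ i := fun h => hX (by rw [h])
      rw [hui, huj j hji, cylinderGraph_adj_iff hm, hpos j] at hj
      exact ⟨hX, g j, hgn j, fun h => hji (hg h), hj, by rw [hgf]⟩
    · rintro ⟨hX, b, hb, hba, hadj, rfl⟩
      have hji : f b ≠ i := fun h => hba (by rw [← h, hgi b hb])
      refine ⟨⟨f b, ?_, rfl⟩, hX⟩
      rw [hui, huj _ hji, cylinderGraph_adj_iff hm, hpos, hgi b hb]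
      exact hadj
  refine ⟨v, hv, fun i w hw => ?_⟩
  have hq : n ≤ 2 * (w.2 : ℕ) + w.1 := by
    by_contra! hlt
    refine hw (f (2 * (w.2 : ℕ) + w.1)) ?_
    have h1 := hpos (f (2 * (w.2 : ℕ) + w.1))
    rw [hgi _ hlt] at h1
    have h2 := w.1.2
    have h3 := (v (f (2 * (w.2 : ℕ) + w.1))).1.2
    ext <;> omega
  have hq' : 2 * (w.2 : ℕ) + w.1 < 2 * m := by
    have h2 := w.1.2
    have h3 := w.2.2
    omega
  rw [utility, utility, hset i (jump v i w) w (by simp [jump])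
    (fun j hj => by simp [jump, Function.update_of_ne hj]), hset i v (v i) rfl (fun _ _ => rfl),
    hpos]
  exact h _ (hgn i) _ hq hq'

section Bounds
variable {m n : ℕ} {τ : ℕ → T} {a q : ℕ}

theorem seen_finite : (seen m n τ a q).Finite :=
  ((Set.finite_Iio n).image τ).subset fun _ ⟨_, b, hb, _, _, h⟩ => ⟨b, hb, h⟩

theorem ncard_seen_le_one (X : T)
    (h : ∀ b < n, b ≠ a → LadderAdj m q b → τ b ≠ τ a → τ b = X) :
    (seen m n τ a q).ncard ≤ 1 := by
  rw [← Set.ncard_singleton X]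
  refine Set.ncard_le_ncard ?_ (Set.toFinite _)
  rintro _ ⟨hX, b, hb, hba, hadj, rfl⟩
  exact h b hb hba hadj hX

theorem ncard_seen_le_two (X Y : T)
    (h : ∀ b < n, b ≠ a → LadderAdj m q b → τ b ≠ τ a → τ b = X ∨ τ b = Y) :
    (seen m n τ a q).ncard ≤ 2 := by
  refine (Set.ncard_le_ncard ?_ (Set.toFinite {X, Y})).trans (Set.ncard_insert_le X {Y} |>.trans ?_)
  · rintro _ ⟨hX, b, hb, hba, hadj, rfl⟩
    exact h b hb hba hadj hX
  · rw [Set.ncard_singleton]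

theorem one_le_ncard_seen {b : ℕ} (hb : b < n) (hadj : LadderAdj m q b) (hne : τ b ≠ τ a) :
    1 ≤ (seen m n τ a q).ncard :=
  (Set.ncard_pos seen_finite).2 ⟨τ b, hne, b, hb, fun h => hne (by rw [h]), hadj, rfl⟩

theorem two_le_ncard_seen {b c : ℕ} (hb : b < n) (hc : c < n) (hab : LadderAdj m q b)
    (hac : LadderAdj m q c) (hba : τ b ≠ τ a) (hca : τ c ≠ τ a) (hbc : τ b ≠ τ c) :
    2 ≤ (seen m n τ a q).ncard :=
  (Set.one_lt_ncard seen_finite).2 ⟨τ b, ⟨hba, b, hb, fun h => hba (by rw [h]), hab, rfl⟩,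
    τ c, ⟨hca, c, hc, fun h => hca (by rw [h]), hac, rfl⟩, hbc⟩

/-- The only occupied positions next to an empty one are the first two and the last two. -/
theorem LadderAdj.of_empty {b : ℕ} (hb : b < n) (hq : n ≤ q) (hq' : q < 2 * m)
    (h : LadderAdj m q b) :
    (q = n ∧ b + 2 = n) ∨ (q = n + 1 ∧ b + 1 = n) ∨ (q = n ∧ b + 1 = n ∧ n % 2 = 1) ∨
      (q + 2 = 2 * m ∧ b = 0) ∨ (q + 1 = 2 * m ∧ b = 1) := by
  unfold LadderAdj at h; omega

end Bounds
end Ladder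

/-! ### Stable patterns of types -/

section Stability

variable {T : Type*} {m n : ℕ} {τ : ℕ → T}

/-- `SeesOther m n τ a` says that the agent at position `a` has a neighbor of another type. -/
def SeesOther (m n : ℕ) (τ : ℕ → T) (a : ℕ) : Prop :=
  ∃ b < n, LadderAdj m a b ∧ τ b ≠ τ a

theorem SeesOther.one_le_ncard_seen {a : ℕ} (h : SeesOther m n τ a) :
    1 ≤ (seen m n τ a a).ncard :=
  let ⟨_, hb, hadj, hne⟩ := h
  VarietyJumpGame.one_le_ncard_seen hb hadj hne

/-- An agent with three neighbors sees another type when no type has four agents. -/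
theorem seesOther_of_card_le_three {a : ℕ}
    (h3 : ∀ X, ∀ s : Finset ℕ, (∀ b ∈ s, b < n ∧ τ b = X) → s.card ≤ 3)
    (ha : 2 ≤ a) (han : a + 3 ≤ n) : SeesOther m n τ a := by
  by_contra hcon
  have hsame : ∀ b < n, LadderAdj m a b → τ b = τ a := fun b hb hadj => by
    by_contra hne
    exact hcon ⟨b, hb, hadj, hne⟩
  obtain ⟨p, hp, hpa, hpn⟩ : ∃ p, p / 2 = a / 2 ∧ p ≠ a ∧ p < n := by
    rcases Nat.mod_two_eq_zero_or_one a with h | h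
    · exact ⟨a + 1, by omega⟩
    · exact ⟨a - 1, by omega⟩
  have hcard := h3 (τ a) {a - 2, a, a + 2, p} (by
    simp only [Finset.mem_insert, Finset.mem_singleton]
    rintro b (rfl | rfl | rfl | rfl)
    · exact ⟨by omega, hsame _ (by omega) (by unfold LadderAdj; omega)⟩
    · exact ⟨by omega, rfl⟩
    · exact ⟨by omega, hsame _ (by omega) (by unfold LadderAdj; omega)⟩
    · exact ⟨by omega, hsame _ (by omega) (by unfold LadderAdj; omega)⟩)
  rw [Finset.card_insert_of_notMem, Finset.card_insert_of_notMem, Finset.card_insert_of_notMem,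
    Finset.card_singleton] at hcard
  · omega
  all_goals simp only [Finset.mem_insert, Finset.mem_singleton]; omega

/-- If every empty position has at most one type next to it, it suffices that every agent sees
another type. -/
theorem isStable_of_seesOther (X : ℕ → T)
    (hX : ∀ q, n ≤ q → q < 2 * m → ∀ b < n, LadderAdj m q b → τ b = X q)
    (h : ∀ a < n, SeesOther m n τ a) : IsStable m n τ := fun a ha q hq hq' =>
  (ncard_seen_le_one (X q) fun b hb _ hadj _ => hX q hq hq' b hb hadj).trans
    (h a ha).one_le_ncard_seen

/-- If only agents of type `A` are next to empty positions, it suffices that every agent of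
another type sees another type. -/
theorem isStable_of_boundary_eq (A : T)
    (hA : ∀ q, n ≤ q → q < 2 * m → ∀ b < n, LadderAdj m q b → τ b = A)
    (h : ∀ a < n, τ a ≠ A → SeesOther m n τ a) : IsStable m n τ := by
  intro a ha q hq hq'
  by_cases haA : τ a = A
  · have : seen m n τ a q = ∅ := Set.eq_empty_of_forall_notMem fun X hX => by
      obtain ⟨hne, b, hb, -, hadj, rfl⟩ := hX
      exact hne ((hA q hq hq' b hb hadj).trans haA.symm)
    rw [this, Set.ncard_empty]
    exact Nat.zero_le _
  · exact (ncard_seen_le_one A fun b hb _ hadj _ => hA q hq hq' b hb hadj).trans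
      (h a ha haA).one_le_ncard_seen

/-- Type `A` takes the corners, and the two agents of a column whose positions are not next to a
corner have different types or type `A`. -/
theorem isStable_of_four_corners (hn : 6 ≤ n) (A : T) (h0 : τ 0 = A) (h1 : τ 1 = A)
    (h2 : τ (n - 1) = A) (h3 : τ (n - 2) = A)
    (hpair : ∀ j, 2 * j + 8 ≤ n → τ (2 * j + 4) = τ (2 * j + 5) → τ (2 * j + 4) = A) :
    IsStable m n τ := by
  refine isStable_of_boundary_eq A (fun q hq hq' b hb hadj => ?_) fun a ha haA => ?_
  · rcases hadj.of_empty hb hq hq' with ⟨-, h⟩ | ⟨-, h⟩ | ⟨-, h, -⟩ | ⟨-, h⟩ | ⟨-, h⟩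
    · rwa [show b = n - 2 by omega]
    · rwa [show b = n - 1 by omega]
    · rwa [show b = n - 1 by omega]
    · rwa [h]
    · rwa [h]
  · have ne : ∀ x, τ x = A → a ≠ x := fun x hx hax => haA (hax ▸ hx)
    have hb0 := ne _ h0
    have hb1 := ne _ h1
    have hb2 := ne _ h2
    have hb3 := ne _ h3
    have other : ∀ b, τ b = A → b < n → LadderAdj m a b → SeesOther m n τ a :=
      fun b hb hbn hadj => ⟨b, hbn, hadj, fun h => haA (h ▸ hb)⟩
    by_cases ha2 : a = 2
    · exact other 0 h0 (by omega) (by unfold LadderAdj; omega)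
    by_cases ha3 : a = 3
    · exact other 1 h1 (by omega) (by unfold LadderAdj; omega)
    -- for odd `n`, position `n - 3` shares its column with position `n - 2`
    by_cases hlast : n % 2 = 1 ∧ a = n - 3
    · exact other (n - 1) h2 (by omega) (by unfold LadderAdj; omega)
    rcases Nat.mod_two_eq_zero_or_one a with h | h
    · obtain ⟨j, rfl⟩ : ∃ j, a = 2 * j + 4 := ⟨(a - 4) / 2, by omega⟩
      exact ⟨2 * j + 5, by omega, by unfold LadderAdj; omega,
        fun h => haA (hpair j (by omega) h.symm)⟩
    · obtain ⟨j, rfl⟩ : ∃ j, a = 2 * j + 5 := ⟨(a - 5) / 2, by omega⟩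
      exact ⟨2 * j + 4, by omega, by unfold LadderAdj; omega,
        fun h => haA (h ▸ hpair j (by omega) h)⟩

/-- The occupied corners in row `0` have type `A` and those in row `1` have type `B`, so that each
empty node sees only one type. -/
theorem isStable_of_even_two_types (hn : 4 ≤ n) (heven : n % 2 = 0) {A B : T} (hAB : A ≠ B)
    (h0 : τ 0 = A) (h1 : τ 1 = B) (h2 : τ (n - 2) = A) (h3 : τ (n - 1) = B)
    (hI : ∀ a, 2 ≤ a → a + 3 ≤ n → SeesOther m n τ a) : IsStable m n τ := by
  refine isStable_of_seesOther (fun q => if q % 2 = 0 then A else B)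
    (fun q hq hq' b hb hadj => ?_) fun a ha => ?_
  · rcases hadj.of_empty hb hq hq' with ⟨h, h'⟩ | ⟨h, h'⟩ | ⟨-, -, h⟩ | ⟨h, h'⟩ | ⟨h, h'⟩
    · rw [if_pos (by omega), show b = n - 2 by omega, h2]
    · rw [if_neg (by omega), show b = n - 1 by omega, h3]
    · omega
    · rw [if_pos (by omega), h', h0]
    · rw [if_neg (by omega), h', h1]
  · by_cases ha0 : a = 0
    · subst ha0
      exact ⟨1, by omega, by unfold LadderAdj; omega, by rw [h0, h1]; exact hAB.symm⟩
    by_cases ha1 : a = 1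
    · subst ha1
      exact ⟨0, by omega, by unfold LadderAdj; omega, by rw [h0, h1]; exact hAB⟩
    by_cases ha2 : a = n - 2
    · subst ha2
      exact ⟨n - 1, by omega, by unfold LadderAdj; omega, by rw [h2, h3]; exact hAB.symm⟩
    by_cases ha3 : a = n - 1
    · subst ha3
      exact ⟨n - 2, by omega, by unfold LadderAdj; omega, by rw [h2, h3]; exact hAB⟩
    exact hI a (by omega) (by omega)

/-- Type `A` is the only one that may occur more than once, and its agents stand at the positions
`n - 1`, `n - 2` and, if `c` holds, `0`. An empty node sees at most one type besides `A`, so agents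
of type `A` can reach utility at most one and the others at most two, which they have. -/
theorem isStable_of_even_one_type (hn : 4 ≤ n) (heven : n % 2 = 0) (A : T) (c : Prop)
    (hc : c → 6 ≤ n ∧ τ 0 = A) (h2 : τ (n - 2) = A) (h3 : τ (n - 1) = A)
    (hA : ∀ a < n, τ a = A → a + 1 = n ∨ a + 2 = n ∨ (a = 0 ∧ c))
    (hsingle : ∀ a < n, ∀ b < n, τ a ≠ A → τ a = τ b → a = b) : IsStable m n τ := by
  -- an agent of another type than `A` sees at least two types
  have two : ∀ a < n, τ a ≠ A → 2 ≤ (seen m n τ a a).ncard := by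
    intro a ha haA
    have ne : ∀ b < n, b ≠ a → τ b ≠ τ a := fun b hb hba h =>
      hba (hsingle a ha b hb haA h.symm).symm
    have ne' : ∀ b < n, ∀ b' < n, τ b ≠ A → b ≠ b' → τ b ≠ τ b' := fun b hb b' hb' hbA hbb h =>
      hbb (hsingle b hb b' hb' hbA h)
    have ha2 : a ≠ n - 2 := fun h => haA (h ▸ h2)
    have ha3 : a ≠ n - 1 := fun h => haA (h ▸ h3)
    by_cases ha0 : a = 0
    · subst ha0
      exact two_le_ncard_seen (b := 1) (c := 2) (by omega) (by omega) (by unfold LadderAdj; omega)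
        (by unfold LadderAdj; omega) (ne _ (by omega) (by omega)) (ne _ (by omega) (by omega))
        (ne' _ (by omega) _ (by omega) (fun h => by have := hA _ (by omega) h; omega) (by omega))
    by_cases ha1 : a = 1
    · subst ha1
      refine two_le_ncard_seen (b := 0) (c := 3) (by omega) (by omega) (by unfold LadderAdj; omega)
        (by unfold LadderAdj; omega) (ne _ (by omega) (by omega)) (ne _ (by omega) (by omega))
        fun h => ?_
      by_cases h0 : τ 0 = A
      · have hh0 := hA 0 (by omega) h0
        have hh3 := hA 3 (by omega) (h ▸ h0)
        have : c → 6 ≤ n := fun h => (hc h).1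
        grind
      · have := hsingle 0 (by omega) 3 (by omega) h0 h
        omega
    · obtain ⟨p, hp, hpa, hp2, hpn⟩ : ∃ p, p / 2 = a / 2 ∧ p ≠ a ∧ 2 ≤ p ∧ p + 3 ≤ n := by
        rcases Nat.mod_two_eq_zero_or_one a with h | h
        · exact ⟨a + 1, by omega⟩
        · exact ⟨a - 1, by omega⟩
      exact two_le_ncard_seen (b := p) (c := a - 2) (by omega) (by omega)
        (by unfold LadderAdj; omega)
        (by unfold LadderAdj; omega) (ne _ (by omega) (by omega)) (ne _ (by omega) (by omega))
        (ne' _ (by omega) _ (by omega) (fun h => by have := hA _ (by omega) h; omega) (by omega))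
  have one : ∀ a < n, τ a = A → 1 ≤ (seen m n τ a a).ncard := by
    intro a ha haA
    have : c → 6 ≤ n := fun h => (hc h).1
    have other : ∀ b < n, b + 1 ≠ n → b + 2 ≠ n → ¬ (b = 0 ∧ c) → LadderAdj m a b →
        1 ≤ (seen m n τ a a).ncard := fun b hb hb1 hb2 hb0 hadj =>
      one_le_ncard_seen hb hadj fun h => by
        rcases hA b hb (h.trans haA) with h' | h' | h' <;> contradiction
    rcases hA a ha haA with h | h | ⟨h, hc'⟩
    · exact other (n - 3) (by omega) (by omega) (by omega) (by omega) (by unfold LadderAdj; omega)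
    · exact other (n - 4) (by omega) (by omega) (by omega) (fun h => by have := this h.2; omega)
        (by unfold LadderAdj; omega)
    · have := this hc'
      exact other 1 (by omega) (by omega) (by omega) (by omega) (by unfold LadderAdj; omega)
  -- every empty position has at most one type besides `A` next to it
  have hsee : ∀ q, n ≤ q → q < 2 * m → ∀ b < n, LadderAdj m q b →
      τ b = A ∨ τ b = τ (q % 2) := by
    intro q hq hq' b hb hadj
    rcases hadj.of_empty hb hq hq' with ⟨h, h'⟩ | ⟨h, h'⟩ | ⟨-, -, h⟩ | ⟨h, h'⟩ | ⟨h, h'⟩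
    · left; rwa [show b = n - 2 by omega]
    · left; rwa [show b = n - 1 by omega]
    · omega
    · right; rw [h', show q % 2 = 0 by omega]
    · right; rw [h', show q % 2 = 1 by omega]
  intro a ha q hq hq'
  by_cases haA : τ a = A
  · refine le_trans (ncard_seen_le_one (τ (q % 2)) fun b hb _ hadj hne => ?_) (one a ha haA)
    exact (hsee q hq hq' b hb hadj).resolve_left fun h => hne (h.trans haA.symm)
  · exact le_trans (ncard_seen_le_two A (τ (q % 2)) fun b hb _ hadj _ => hsee q hq hq' b hb hadj)
      (two a ha haA)

/-- There is one empty node, and its three neighbors have type `A`. -/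
theorem isStable_of_odd_of_one_empty (hn : 5 ≤ n) (hnm : n + 1 = 2 * m) (A : T)
    (h1 : τ 1 = A) (h2 : τ (n - 2) = A) (h3 : τ (n - 1) = A)
    (hI : ∀ a, 2 ≤ a → a + 3 ≤ n → SeesOther m n τ a) : IsStable m n τ := by
  refine isStable_of_boundary_eq A (fun q hq hq' b hb hadj => ?_) fun a ha haA => ?_
  · rcases hadj.of_empty hb hq hq' with ⟨-, h⟩ | ⟨-, h⟩ | ⟨-, h, -⟩ | ⟨h, -⟩ | ⟨-, h⟩
    · rwa [show b = n - 2 by omega]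
    · rwa [show b = n - 1 by omega]
    · rwa [show b = n - 1 by omega]
    · omega
    · rwa [h]
  · have ne : ∀ x, τ x = A → a ≠ x := fun x hx hax => haA (hax ▸ hx)
    have hb1 := ne _ h1
    have hb2 := ne _ h2
    have hb3 := ne _ h3
    by_cases ha0 : a = 0
    · subst ha0
      exact ⟨1, by omega, by unfold LadderAdj; omega, fun h => haA (h ▸ h1)⟩
    exact hI a (by omega) (by omega)

/-- With at least three empty nodes, all of them see only type `A`, except for the one next to
position `1`. -/
theorem isStable_of_odd_of_three_empty (hn : 5 ≤ n) (hodd : n % 2 = 1) (hnm : n + 3 ≤ 2 * m)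
    (A : T) (h0 : τ 0 = A) (h2 : τ (n - 2) = A) (h3 : τ (n - 1) = A)
    (hA : ∀ a < n, τ a = A → a = 0 ∨ a + 1 = n ∨ a + 2 = n)
    (hI : ∀ a, 2 ≤ a → a + 3 ≤ n → SeesOther m n τ a) : IsStable m n τ := by
  refine isStable_of_seesOther (fun q => if q + 1 = 2 * m then τ 1 else A)
    (fun q hq hq' b hb hadj => ?_) fun a ha => ?_
  · rcases hadj.of_empty hb hq hq' with ⟨h, h'⟩ | ⟨h, h'⟩ | ⟨h, h', -⟩ | ⟨h, h'⟩ | ⟨h, h'⟩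
    · rwa [if_neg (by omega), show b = n - 2 by omega]
    · rwa [if_neg (by omega), show b = n - 1 by omega]
    · rwa [if_neg (by omega), show b = n - 1 by omega]
    · rw [if_neg (by omega), h', h0]
    · rw [if_pos (by omega), h']
  · have hA1 : τ 1 ≠ A := fun h => by have := hA 1 (by omega) h; omega
    have hAl : τ (n - 3) ≠ A := fun h => by have := hA (n - 3) (by omega) h; omega
    by_cases ha0 : a = 0
    · subst ha0
      exact ⟨1, by omega, by unfold LadderAdj; omega, by rwa [h0]⟩
    by_cases ha1 : a = 1
    · subst ha1
      exact ⟨0, by omega, by unfold LadderAdj; omega, by rw [h0]; exact hA1.symm⟩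
    by_cases ha2 : a = n - 2
    · subst ha2
      exact ⟨n - 3, by omega, by unfold LadderAdj; omega, by rwa [h2]⟩
    by_cases ha3 : a = n - 1
    · subst ha3
      exact ⟨n - 3, by omega, by unfold LadderAdj; omega, by rwa [h3]⟩
    exact hI a (by omega) (by omega)

/-- Agents of equal type stand at positions `2 * c + 1` and `2 * c + 2`, which lie diagonally in
consecutive columns. As they are neither adjacent nor at distance two in a row, an agent away from
the ends sees two types in its row, and an empty node sees at most two types. -/
theorem isStable_of_odd_of_diagonal (hn : 5 ≤ n) (hodd : n % 2 = 1)
    (hlast : τ (n - 2) = τ (n - 1))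
    (h : ∀ a < n, ∀ b < n, τ a = τ b → (a + 1) / 2 = (b + 1) / 2) : IsStable m n τ := by
  have ne : ∀ a b, a < n → b < n → (a + 1) / 2 ≠ (b + 1) / 2 → τ a ≠ τ b :=
    fun a b ha hb hab h' => hab (h a ha b hb h')
  have two : ∀ a, 1 ≤ a → a + 3 ≤ n → 2 ≤ (seen m n τ a a).ncard := by
    intro a ha han
    by_cases ha1 : a = 1
    · subst ha1
      exact two_le_ncard_seen (b := 0) (c := 3) (by omega) (by omega) (by unfold LadderAdj; omega)
        (by unfold LadderAdj; omega) (ne _ _ (by omega) (by omega) (by omega))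
        (ne _ _ (by omega) (by omega) (by omega)) (ne _ _ (by omega) (by omega) (by omega))
    · exact two_le_ncard_seen (b := a - 2) (c := a + 2) (by omega) (by omega)
        (by unfold LadderAdj; omega) (by unfold LadderAdj; omega)
        (ne _ _ (by omega) (by omega) (by omega))
        (ne _ _ (by omega) (by omega) (by omega)) (ne _ _ (by omega) (by omega) (by omega))
  intro a ha q hq hq'
  have hsee : ∀ b < n, b ≠ a → LadderAdj m q b →
      τ b = τ (n - 1) ∨ τ b = if q + 2 = 2 * m then τ 0 else τ 1 := by
    intro b hb hba hadj
    rcases hadj.of_empty hb hq hq' with ⟨h, h'⟩ | ⟨h, h'⟩ | ⟨h, h', -⟩ | ⟨h, h'⟩ | ⟨h, h'⟩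
    · left; rw [← hlast, show b = n - 2 by omega]
    · left; rw [show b = n - 1 by omega]
    · left; rw [show b = n - 1 by omega]
    · right; rw [if_pos h, h']
    · right; rw [if_neg (by omega), h']
  by_cases hmid : 1 ≤ a ∧ a + 3 ≤ n
  · exact le_trans (ncard_seen_le_two _ _ fun b hb hba hadj _ => hsee b hb hba hadj)
      (two a hmid.1 hmid.2)
  by_cases ha0 : a = 0
  · subst ha0
    by_cases hone : n + 1 = 2 * m
    · refine le_trans (ncard_seen_le_two _ _ fun b hb hba hadj _ => hsee b hb hba hadj) ?_
      -- the last occupied position closes the cycle of row `0`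
      exact two_le_ncard_seen (b := 1) (c := n - 1) (by omega) (by omega)
        (by unfold LadderAdj; omega) (by unfold LadderAdj; omega)
        (ne _ _ (by omega) (by omega) (by omega))
        (ne _ _ (by omega) (by omega) (by omega)) (ne _ _ (by omega) (by omega) (by omega))
    · refine le_trans (ncard_seen_le_one (if q + 1 = 2 * m then τ 1 else τ (n - 1))
        fun b hb hba hadj _ => ?_) (one_le_ncard_seen (b := 1) (by omega)
          (by unfold LadderAdj; omega) (ne _ _ (by omega) (by omega) (by omega)))
      rcases hadj.of_empty hb hq hq' with ⟨h, h'⟩ | ⟨h, h'⟩ | ⟨h, h', -⟩ | ⟨h, h'⟩ | ⟨h, h'⟩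
      · rw [if_neg (by omega), ← hlast, show b = n - 2 by omega]
      · rw [if_neg (by omega), show b = n - 1 by omega]
      · rw [if_neg (by omega), show b = n - 1 by omega]
      · exact absurd h' hba
      · rw [if_pos h, h']
  · have haA : τ a = τ (n - 1) := by
      by_cases ha1 : a = n - 1
      · rw [ha1]
      · rw [← hlast, show a = n - 2 by omega]
    refine le_trans (ncard_seen_le_one _ fun b hb hba hadj hne =>
      (hsee b hb hba hadj).resolve_left fun h => hne (h.trans haA.symm))
      (one_le_ncard_seen (b := n - 3) (by omega) (by unfold LadderAdj; omega)
        (ne _ _ (by omega) (by omega) (by omega)))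

end Stability

/-! ### Arranging the agents -/

section Arrangement

variable {N T : Type*} {n : ℕ} {t : N → T} {f : ℕ → N}

theorem exists_bijOn_extending [Fintype N] [Nonempty N] (hn : Fintype.card N = n) {r : ℕ} {p : Fin r → ℕ}
    (hp : Function.Injective p) (hpn : ∀ i, p i < n) {g : Fin r → N}
    (hg : Function.Injective g) :
    ∃ f : ℕ → N, Set.BijOn f (Set.Iio n) Set.univ ∧ ∀ i, f (p i) = g i := by
  classical
  let e : Fin n ≃ N := (Fintype.equivFinOfCardEq hn).symm
  have hP : Function.Injective fun i => (⟨p i, hpn i⟩ : Fin n) := fun i j h =>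
    hp (Fin.mk.inj_iff.1 h)
  have hQ : Function.Injective fun i => e.symm (g i) := fun i j h => hg (e.symm.injective h)
  let σ : {x // x ∈ Set.range fun i => (⟨p i, hpn i⟩ : Fin n)} ≃
      {x // x ∈ Set.range fun i => e.symm (g i)} :=
    (Equiv.ofInjective _ hP).symm.trans (Equiv.ofInjective _ hQ)
  let E : Fin n ≃ N := σ.extendSubtype.trans e
  refine ⟨fun a => if h : a < n then E ⟨a, h⟩ else Classical.arbitrary N,
    ⟨fun _ _ => Set.mem_univ _, fun a ha b hb hab => ?_, fun i _ => ?_⟩, fun i => ?_⟩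
  · simp only [Set.mem_Iio] at ha hb
    simp only [dif_pos ha, dif_pos hb] at hab
    exact Fin.mk.inj_iff.1 (E.injective hab)
  · refine ⟨E.symm i, (E.symm i).2, ?_⟩
    simp only [dif_pos (E.symm i).2, Fin.eta, Equiv.apply_symm_apply]
  · simp only [dif_pos (hpn i)]
    have hmem : (⟨p i, hpn i⟩ : Fin n) ∈ Set.range fun i => (⟨p i, hpn i⟩ : Fin n) := ⟨i, rfl⟩
    simp only [E, Equiv.trans_apply, Equiv.extendSubtype_apply_of_mem σ _ hmem, σ]
    have : (Equiv.ofInjective _ hP).symm ⟨⟨p i, hpn i⟩, hmem⟩ = i := by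
      rw [Equiv.symm_apply_eq]; rfl
    rw [this]
    exact e.apply_symm_apply _

theorem exists_bijOn [Fintype N] (hn : Fintype.card N = n) [Nonempty N] :
    ∃ f : ℕ → N, Set.BijOn f (Set.Iio n) Set.univ :=
  let ⟨f, hf, _⟩ := exists_bijOn_extending hn (p := (Fin.elim0 : Fin 0 → ℕ)) (g := Fin.elim0)
    (fun i => i.elim0) (fun i => i.elim0) (fun i => i.elim0)
  ⟨f, hf⟩

theorem card_le_ncard_type [Fintype N] (hf : Set.BijOn f (Set.Iio n) Set.univ) (X : T) (s : Finset ℕ)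
    (hs : ∀ a ∈ s, a < n ∧ (t ∘ f) a = X) : s.card ≤ {i | t i = X}.ncard := by
  rw [← Set.ncard_coe_finset s]
  exact Set.ncard_le_ncard_of_injOn f (fun a ha => (hs a ha).2)
    (hf.injOn.mono fun a ha => (hs a ha).1) (Set.toFinite _)

theorem ncard_type_le_card (hf : Set.BijOn f (Set.Iio n) Set.univ) (X : T) (s : Finset ℕ)
    (hs : ∀ a < n, (t ∘ f) a = X → a ∈ s) : {i | t i = X}.ncard ≤ s.card := by
  classical
  rw [← Set.ncard_coe_finset s]
  refine le_trans (Set.ncard_le_ncard (t := f '' s) ?_ (Set.toFinite _))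
    (Set.ncard_image_le s.finite_toSet)
  intro i hi
  obtain ⟨a, ha, rfl⟩ := hf.surjOn (Set.mem_univ i)
  exact ⟨a, hs a ha hi, rfl⟩

theorem exists_injective_of_le_ncard [Fintype N] {r : ℕ} {X : T} (h : r ≤ {i | t i = X}.ncard) :
    ∃ g : Fin r → N, Function.Injective g ∧ ∀ j, t (g j) = X := by
  classical
  obtain ⟨g⟩ : Nonempty (Fin r ↪ {i // t i = X}) := by
    refine Function.Embedding.nonempty_of_card_le ?_
    rw [Fintype.card_fin, ← Nat.card_eq_fintype_card]
    exact h
  exact ⟨fun j => g j, fun a b hab => g.injective (Subtype.ext hab), fun j => (g j).2⟩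

theorem ncard_type_add_ncard_type_lt [Fintype N] [Fintype T] (ht : Function.Surjective t)
    (hT : 3 ≤ Fintype.card T) {A B : T} (hAB : A ≠ B) :
    {i | t i = A}.ncard + {i | t i = B}.ncard < Fintype.card N := by
  classical
  obtain ⟨X, hX⟩ : ∃ X, X ∉ ({A, B} : Finset T) := by
    by_contra! h
    have h1 := Finset.card_le_card (fun x _ => h x : (Finset.univ : Finset T) ⊆ {A, B})
    have h2 := Finset.card_le_two (a := A) (b := B)
    rw [Finset.card_univ] at h1
    omega
  simp only [Finset.mem_insert, Finset.mem_singleton, not_or] at hX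
  obtain ⟨i, rfl⟩ := ht X
  have hdisj : Disjoint {i | t i = A} {i | t i = B} :=
    Set.disjoint_left.2 fun j hj hj' => hAB (hj.symm.trans hj')
  rw [← Set.ncard_union_eq hdisj (Set.toFinite _) (Set.toFinite _), ← Nat.card_eq_fintype_card,
    ← Set.ncard_univ]
  exact Set.ncard_lt_ncard (Set.ssubset_univ_iff.2 fun h => by
    rcases (h ▸ Set.mem_univ i : i ∈ {i | t i = A} ∪ {i | t i = B}) with h | h
    exacts [hX.1 h, hX.2 h]) (Set.toFinite _)

/-- The agents can be listed so that equal types are contiguous and type `A` comes first. -/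
theorem exists_bijOn_sorted [Fintype N] [Nonempty N] [Fintype T] (hn : Fintype.card N = n) (t : N → T)
    (A : T) :
    ∃ f : ℕ → N, Set.BijOn f (Set.Iio n) Set.univ ∧
      (∀ a b c, a ≤ b → b ≤ c → c < n → t (f a) = t (f c) → t (f b) = t (f a)) ∧
      ∀ a b, a ≤ b → b < n → t (f b) = A → t (f a) = A := by
  classical
  let K : T → ℕ := fun X => if X = A then 0 else Fintype.equivFin T X + 1
  have hK : Function.Injective K := by
    intro X Y h
    simp only [K] at h
    split_ifs at h with h1 h2
    · rw [h1, h2]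
    · exact (Fintype.equivFin T).injective (Fin.ext (by omega))
  obtain ⟨f₀, hf₀⟩ := exists_bijOn hn
  let σ := Tuple.sort fun j : Fin n => K (t (f₀ j))
  have hσ : Monotone ((fun j : Fin n => K (t (f₀ j))) ∘ σ) := Tuple.monotone_sort _
  let f : ℕ → N := fun a => if h : a < n then f₀ (σ ⟨a, h⟩) else Classical.arbitrary N
  have hfa : ∀ a (h : a < n), f a = f₀ (σ ⟨a, h⟩) := fun a h => dif_pos h
  have mono : ∀ a b, a ≤ b → b < n → K (t (f a)) ≤ K (t (f b)) := by
    intro a b hab hb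
    rw [hfa a (by omega), hfa b hb]
    exact hσ (show (⟨a, by omega⟩ : Fin n) ≤ ⟨b, hb⟩ from hab)
  refine ⟨f, ⟨fun _ _ => Set.mem_univ _, fun a ha b hb hab => ?_, fun i _ => ?_⟩, ?_, ?_⟩
  · rw [hfa a ha, hfa b hb] at hab
    exact Fin.mk.inj_iff.1 (σ.injective (Fin.ext (hf₀.injOn (Fin.is_lt _) (Fin.is_lt _) hab)))
  · obtain ⟨a, ha, rfl⟩ := hf₀.surjOn (Set.mem_univ i)
    refine ⟨σ.symm ⟨a, ha⟩, Fin.is_lt _, ?_⟩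
    rw [hfa _ (Fin.is_lt _)]
    simp
  · intro a b c hab hbc hc h
    have h1 := mono a b hab (by omega)
    have h2 := mono b c hbc hc
    rw [← h] at h2
    exact hK (le_antisymm h2 h1)
  · intro a b hab hb h
    have h1 := mono a b hab hb
    rw [h] at h1
    exact hK (le_antisymm h1 (by simp [K]))

/-- If no type has three agents in `s`, the agents of `s` can be listed so that agents of equal
type are consecutive and, counted from the end, each pair of equals fills a block of length two;
if there is such a pair, one of them comes last. -/
theorem exists_bijOn_paired [Nonempty N] (t : N → T) (n : ℕ) :
    ∀ s : Finset N, s.card = n →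
      (∀ x ∈ s, ∀ y ∈ s, ∀ z ∈ s, x ≠ y → t x = t y → t z = t x → z = x ∨ z = y) →
      ∃ f : ℕ → N, Set.BijOn f (Set.Iio n) s ∧
        (∀ a < n, ∀ b < n, t (f a) = t (f b) → (a + n % 2) / 2 = (b + n % 2) / 2) ∧
        ((∃ x ∈ s, ∃ y ∈ s, x ≠ y ∧ t x = t y) → t (f (n - 2)) = t (f (n - 1))) := by
  classical
  induction n using Nat.strong_induction_on with
  | _ n ih =>
  intro s hs h
  by_cases hpair : ∃ x ∈ s, ∃ y ∈ s, x ≠ y ∧ t x = t y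
  · obtain ⟨x, hx, y, hy, hxy, hxyt⟩ := hpair
    have hcard : ((s.erase x).erase y).card = n - 2 := by
      rw [Finset.card_erase_of_mem (Finset.mem_erase.2 ⟨hxy.symm, hy⟩),
        Finset.card_erase_of_mem hx, hs]
      rfl
    have hn2 : 2 ≤ n := by
      rw [← hs]
      exact Finset.one_lt_card.2 ⟨x, hx, y, hy, hxy⟩
    obtain ⟨k, rfl⟩ : ∃ k, n = k + 2 := ⟨n - 2, by omega⟩
    obtain ⟨f, hf, hblock, -⟩ := ih k (by omega) ((s.erase x).erase y) (by simpa using hcard)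
      fun x' hx' y' hy' z hz => h x' (Finset.mem_of_mem_erase (Finset.mem_of_mem_erase hx'))
        y' (Finset.mem_of_mem_erase (Finset.mem_of_mem_erase hy'))
        z (Finset.mem_of_mem_erase (Finset.mem_of_mem_erase hz))
    let F : ℕ → N := fun a => if a < k then f a else if a = k then x else y
    have hF : ∀ a < k, F a = f a := fun a ha => if_pos ha
    have hFk : F k = x := by simp [F]
    have hFk1 : F (k + 1) = y := by simp [F]
    have hfs : ∀ a < k, f a ∈ s ∧ f a ≠ x ∧ f a ≠ y := fun a ha => by
      have := hf.mapsTo (show a ∈ Set.Iio k from ha)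
      simp only [Finset.coe_erase, Set.mem_sdiff, Set.mem_singleton_iff, Finset.mem_coe] at this
      tauto
    have hcases : ∀ a < k + 2, a < k ∨ a = k ∨ a = k + 1 := fun a ha => by omega
    have hft : ∀ a < k, t (f a) ≠ t x := fun a ha hat => by
      have := h x hx y hy (f a) (hfs a ha).1 hxy hxyt hat
      have := hfs a ha
      tauto
    refine ⟨F, ⟨fun a ha => ?_, fun a ha b hb hab => ?_, fun i hi => ?_⟩, fun a ha b hb hab => ?_,
      fun _ => ?_⟩
    · rcases hcases a ha with h | rfl | rfl
      · rw [hF a h]; exact (hfs a h).1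
      · rw [hFk]; exact hx
      · rw [hFk1]; exact hy
    · rcases hcases a ha with h | rfl | rfl <;> rcases hcases b hb with h' | rfl | rfl
      · rw [hF a h, hF b h'] at hab
        exact hf.injOn h h' hab
      · rw [hF a h, hFk] at hab
        exact absurd hab (hfs a h).2.1
      · rw [hF a h, hFk1] at hab
        exact absurd hab (hfs a h).2.2
      · rw [hF b h', hFk] at hab
        exact absurd hab.symm (hfs b h').2.1
      · rfl
      · rw [hFk, hFk1] at hab
        exact absurd hab hxy
      · rw [hF b h', hFk1] at hab
        exact absurd hab.symm (hfs b h').2.2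
      · rw [hFk, hFk1] at hab
        exact absurd hab.symm hxy
      · rfl
    · by_cases hix : i = x
      · exact ⟨k, by simp, hFk.trans hix.symm⟩
      by_cases hiy : i = y
      · exact ⟨k + 1, by simp, hFk1.trans hiy.symm⟩
      obtain ⟨a, ha, rfl⟩ := hf.surjOn (show i ∈ (((s.erase x).erase y : Finset N) : Set N) by
        simp only [Finset.coe_erase, Set.mem_sdiff, Set.mem_singleton_iff]; tauto)
      simp only [Set.mem_Iio] at ha
      exact ⟨a, show a < k + 2 by omega, hF a ha⟩
    · rcases hcases a ha with h | rfl | rfl <;> rcases hcases b hb with h' | rfl | rfl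
      · rw [hF a h, hF b h'] at hab
        have := hblock a h b h' hab
        omega
      · rw [hF a h, hFk] at hab
        exact absurd hab (hft a h)
      · rw [hF a h, hFk1, ← hxyt] at hab
        exact absurd hab (hft a h)
      · rw [hF b h', hFk] at hab
        exact absurd hab.symm (hft b h')
      · rfl
      · omega
      · rw [hF b h', hFk1, ← hxyt] at hab
        exact absurd hab.symm (hft b h')
      · omega
      · rfl
    · rw [show k + 2 - 2 = k by omega, show k + 2 - 1 = k + 1 by omega, hFk, hFk1, hxyt]
  · obtain ⟨e⟩ : Nonempty (Fin n ≃ s) := ⟨(Finset.equivFinOfCardEq hs).symm⟩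
    have hinj : ∀ a (ha : a < n) b (hb : b < n),
        t (e ⟨a, ha⟩ : N) = t (e ⟨b, hb⟩ : N) → a = b := fun a ha b hb hab => by
      by_contra hne
      refine hpair ⟨_, (e ⟨a, ha⟩).2, _, (e ⟨b, hb⟩).2, fun h => hne ?_, hab⟩
      exact Fin.mk.inj_iff.1 (e.injective (Subtype.ext h))
    refine ⟨fun a => if h : a < n then e ⟨a, h⟩ else Classical.arbitrary N,
      ⟨fun a ha => ?_, fun a ha b hb hab => ?_, fun i hi => ?_⟩, fun a ha b hb hab => ?_,
      fun h => absurd h hpair⟩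
    · simp only [dif_pos (show a < n from ha)]
      exact (e _).2
    · simp only [dif_pos (show a < n from ha), dif_pos (show b < n from hb)] at hab
      exact hinj a ha b hb (by rw [hab])
    · refine ⟨e.symm ⟨i, hi⟩, Fin.is_lt _, ?_⟩
      simp only [dif_pos (Fin.is_lt _), Fin.eta, Equiv.apply_symm_apply]
    · simp only [dif_pos ha, dif_pos hb] at hab
      rw [hinj a ha b hb hab]

end Arrangement

/-! ### Existence of stable arrangements -/

section Cases

variable {N T : Type*} [Fintype N] {m n p r : ℕ} {t : N → T}

/-- The index in the sorted list of the agent at position `x`, for `n = 2 * p + r + 6` agents and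
`r ≤ 1`: the first four agents of the list stand at the corners, the next `p` at the positions
`2 * j + 4`, the last `p` at the positions `2 * j + 5`, and the `r + 2` agents between them at the
positions that remain. These have a corner as neighbor. -/
def cornerIndex (p r x : ℕ) : ℕ :=
  if x = 0 then 0 else if x = 1 then 1
  else if x = 2 * p + r + 5 then 2 else if x = 2 * p + r + 4 then 3
  else if x = 2 then p + 4 else if x = 3 then p + 5
  else if x = 2 * p + 4 then p + 6
  else if x % 2 = 0 then x / 2 + 2 else x / 2 + p + r + 4

theorem cornerIndex_lt (hr : r ≤ 1) {x : ℕ} (hx : x < 2 * p + r + 6) :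
    cornerIndex p r x < 2 * p + r + 6 := by
  grind [cornerIndex]

theorem cornerIndex_even {j : ℕ} (hj : j < p) : cornerIndex p r (2 * j + 4) = j + 4 := by
  grind [cornerIndex]

theorem cornerIndex_odd {j : ℕ} (hj : j < p) :
    cornerIndex p r (2 * j + 5) = j + p + r + 6 := by
  grind [cornerIndex]

theorem cornerIndex_last : cornerIndex p r (2 * p + r + 5) = 2 := by
  grind [cornerIndex]

theorem cornerIndex_second_last : cornerIndex p r (2 * p + r + 4) = 3 := by
  grind [cornerIndex]

theorem cornerIndex_surjOn (hr : r ≤ 1) :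
    Set.SurjOn (cornerIndex p r) (Set.Iio (2 * p + r + 6)) (Set.Iio (2 * p + r + 6)) := by
  intro y hy
  simp only [Set.mem_Iio] at hy
  simp only [Set.mem_image, Set.mem_Iio]
  by_cases h3 : y ≤ 3
  · have h : y = 0 ∨ y = 1 ∨ y = 2 ∨ y = 3 := by omega
    rcases h with rfl | rfl | rfl | rfl
    · exact ⟨0, by omega, by simp [cornerIndex]⟩
    · exact ⟨1, by omega, by simp [cornerIndex]⟩
    · exact ⟨_, by omega, cornerIndex_last⟩
    · exact ⟨_, by omega, cornerIndex_second_last⟩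
  by_cases h4 : y < p + 4
  · exact ⟨2 * (y - 4) + 4, by omega, by rw [cornerIndex_even (by omega)]; omega⟩
  by_cases h5 : p + r + 6 ≤ y
  · exact ⟨2 * (y - (p + r + 6)) + 5, by omega, by rw [cornerIndex_odd (by omega)]; omega⟩
  by_cases h6 : y = p + 4
  · subst h6
    exact ⟨2, by omega, by grind [cornerIndex]⟩
  by_cases h7 : y = p + 5
  · subst h7
    exact ⟨3, by omega, by grind [cornerIndex]⟩
  · have h8 : y = p + 6 := by omega
    subst h8
    exact ⟨2 * p + 4, by omega, by grind [cornerIndex]⟩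

theorem cornerIndex_bijOn (hr : r ≤ 1) :
    Set.BijOn (cornerIndex p r) (Set.Iio (2 * p + r + 6)) (Set.Iio (2 * p + r + 6)) := by
  have hmaps : Set.MapsTo (cornerIndex p r) (Set.Iio (2 * p + r + 6)) (Set.Iio (2 * p + r + 6)) :=
    fun x hx => cornerIndex_lt hr hx
  refine ⟨hmaps, ?_, cornerIndex_surjOn hr⟩
  have := Finset.injOn_of_surjOn_of_card_le (s := Finset.range (2 * p + r + 6))
    (t := Finset.range (2 * p + r + 6)) (cornerIndex p r)
    (by rwa [Finset.coe_range]) (by rw [Finset.coe_range]; exact cornerIndex_surjOn hr) le_rfl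
  rwa [Finset.coe_range] at this

/-- A largest type `A` with at least four agents occupies the four corners. The agents that share
a column elsewhere are at distance `p + r + 2` in the sorted list. If both were of one type
`B ≠ A`, there would be `p + r + 3` agents of type `B` and hence as many of type `A`, which is too
many in the presence of a third type. -/
theorem exists_isStable_of_four_le [Nonempty N] [Fintype T] (hn : Fintype.card N = n)
    (ht : Function.Surjective t) (hT : 3 ≤ Fintype.card T) (A : T)
    (hmax : ∀ X, {i | t i = X}.ncard ≤ {i | t i = A}.ncard)
    (hA : 4 ≤ {i | t i = A}.ncard) (hn6 : 6 ≤ n) :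
    ∃ f : ℕ → N, Set.BijOn f (Set.Iio n) Set.univ ∧ IsStable m n (t ∘ f) := by
  obtain ⟨f, hf, hcont, hfirst⟩ := exists_bijOn_sorted hn t A
  have h3 : t (f 3) = A := by
    by_contra hne
    have := ncard_type_le_card (t := t) hf A (Finset.range 3) fun a ha haA => by
      by_contra hmem
      rw [Finset.mem_range, not_lt] at hmem
      exact hne (hfirst 3 a hmem ha haA)
    rw [Finset.card_range] at this
    omega
  have hlt3 : ∀ a ≤ 3, t (f a) = A := fun a ha => hfirst a 3 ha (by omega) h3
  obtain ⟨p, r, hr, rfl⟩ : ∃ p r, r ≤ 1 ∧ n = 2 * p + r + 6 :=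
    ⟨(n - 6) / 2, n % 2, by omega, by omega⟩
  have key : ∀ x y, cornerIndex p r x = y → y ≤ 3 → (t ∘ f ∘ cornerIndex p r) x = A :=
    fun x y h hy => by rw [Function.comp_apply, Function.comp_apply, h]; exact hlt3 y hy
  refine ⟨f ∘ cornerIndex p r, hf.comp (cornerIndex_bijOn hr),
    isStable_of_four_corners hn6 A (key 0 0 (by simp [cornerIndex]) (by omega))
      (key 1 1 (by simp [cornerIndex]) (by omega)) (key _ 2 cornerIndex_last (by omega))
      (key _ 3 cornerIndex_second_last (by omega)) fun j hj hj' => ?_⟩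
  simp only [Function.comp_apply, cornerIndex_even (show j < p by omega),
    cornerIndex_odd (show j < p by omega)] at hj' ⊢
  by_contra hne
  have h1 := card_le_ncard_type (t := t) hf (t (f (j + 4)))
    (Finset.Icc (j + 4) (j + p + r + 6)) fun a ha => by
      rw [Finset.mem_Icc] at ha
      exact ⟨by omega, hcont _ a _ ha.1 ha.2 (by omega) hj'⟩
  have h2 := ncard_type_add_ncard_type_lt ht hT (Ne.symm hne)
  have h4 := hmax (t (f (j + 4)))
  rw [Nat.card_Icc] at h1
  omega

theorem seesOther_of_ncard_type_le_three {f : ℕ → N}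
    (hf : Set.BijOn f (Set.Iio n) Set.univ) (h3 : ∀ X, {i | t i = X}.ncard ≤ 3) (a : ℕ)
    (ha : 2 ≤ a) (han : a + 3 ≤ n) : SeesOther m n (t ∘ f) a :=
  seesOther_of_card_le_three (fun X s hs => (card_le_ncard_type hf X s hs).trans (h3 X)) ha han

theorem exists_isStable_of_odd_of_three [Nonempty N] (hn : Fintype.card N = n) (hodd : n % 2 = 1)
    (hn5 : 5 ≤ n) (hnm : n < 2 * m) (A : T) (h3 : ∀ X, {i | t i = X}.ncard ≤ 3)
    (hA : 3 ≤ {i | t i = A}.ncard) :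
    ∃ f : ℕ → N, Set.BijOn f (Set.Iio n) Set.univ ∧ IsStable m n (t ∘ f) := by
  obtain ⟨g, hg, hgA⟩ := exists_injective_of_le_ncard hA
  -- the third agent of type `A` goes next to the empty node if there is just one
  by_cases hone : n + 1 = 2 * m
  · obtain ⟨f, hf, hfp⟩ := exists_bijOn_extending hn (p := ![1, n - 2, n - 1])
      (by intro i j h; fin_cases i <;> fin_cases j <;> simp at h ⊢ <;> omega)
      (by intro i; fin_cases i <;> simp <;> omega) hg
    have f0 : f 1 = g 0 := hfp 0
    have f1 : f (n - 2) = g 1 := hfp 1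
    have f2 : f (n - 1) = g 2 := hfp 2
    exact ⟨f, hf, isStable_of_odd_of_one_empty hn5 hone A
      (by rw [Function.comp_apply, f0, hgA]) (by rw [Function.comp_apply, f1, hgA])
      (by rw [Function.comp_apply, f2, hgA]) (seesOther_of_ncard_type_le_three hf h3)⟩
  · obtain ⟨f, hf, hfp⟩ := exists_bijOn_extending hn (p := ![0, n - 2, n - 1])
      (by intro i j h; fin_cases i <;> fin_cases j <;> simp at h ⊢ <;> omega)
      (by intro i; fin_cases i <;> simp <;> omega) hg
    have f0 : (t ∘ f) 0 = A := by rw [Function.comp_apply, show f 0 = g 0 from hfp 0, hgA]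
    have f1 : (t ∘ f) (n - 2) = A := by
      rw [Function.comp_apply, show f (n - 2) = g 1 from hfp 1, hgA]
    have f2 : (t ∘ f) (n - 1) = A := by
      rw [Function.comp_apply, show f (n - 1) = g 2 from hfp 2, hgA]
    refine ⟨f, hf, isStable_of_odd_of_three_empty hn5 hodd (by omega) A f0 f1 f2
      (fun a ha haA => ?_) (seesOther_of_ncard_type_le_three hf h3)⟩
    by_contra hcon
    have h4 := card_le_ncard_type (t := t) hf A {0, n - 2, n - 1, a} (by
      simp only [Finset.mem_insert, Finset.mem_singleton]
      rintro b (rfl | rfl | rfl | rfl)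
      exacts [⟨by omega, f0⟩, ⟨by omega, f1⟩, ⟨by omega, f2⟩, ⟨ha, haA⟩])
    have h3A := h3 A
    rw [Finset.card_insert_of_notMem, Finset.card_insert_of_notMem,
      Finset.card_insert_of_notMem, Finset.card_singleton] at h4
    · omega
    all_goals simp only [Finset.mem_insert, Finset.mem_singleton]; omega

theorem exists_isStable_of_odd_of_two [Nonempty N] (hn : Fintype.card N = n) (hodd : n % 2 = 1)
    (hn5 : 5 ≤ n) (A : T) (h2 : ∀ X, {i | t i = X}.ncard ≤ 2)
    (hA : 2 ≤ {i | t i = A}.ncard) :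
    ∃ f : ℕ → N, Set.BijOn f (Set.Iio n) Set.univ ∧ IsStable m n (t ∘ f) := by
  obtain ⟨g, hg, hgA⟩ := exists_injective_of_le_ncard hA
  obtain ⟨f, hf, hblock, hlast⟩ := exists_bijOn_paired t n Finset.univ
    (by rw [Finset.card_univ, hn]) fun x _ y _ z _ hxy hxyt hzt => by
      by_contra! hcon
      have h3 : 2 < {i | t i = t x}.ncard := (Set.two_lt_ncard (Set.toFinite _)).2
        ⟨x, rfl, y, hxyt.symm, z, hzt, hxy, hcon.1.symm, hcon.2.symm⟩
      have := h2 (t x)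
      omega
  rw [Finset.coe_univ] at hf
  refine ⟨f, hf, isStable_of_odd_of_diagonal hn5 hodd ?_ fun a ha b hb hab => ?_⟩
  · exact hlast ⟨g 0, Finset.mem_univ _, g 1, Finset.mem_univ _, fun h => by simpa using hg h,
      by rw [hgA, hgA]⟩
  · have := hblock a ha b hb hab
    rwa [hodd] at this

theorem exists_isStable_of_even_of_two_types [Nonempty N] (hn : Fintype.card N = n) (heven : n % 2 = 0)
    (hn4 : 4 ≤ n) {A B : T} (hAB : A ≠ B) (h3 : ∀ X, {i | t i = X}.ncard ≤ 3)
    (hA : 2 ≤ {i | t i = A}.ncard) (hB : 2 ≤ {i | t i = B}.ncard) :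
    ∃ f : ℕ → N, Set.BijOn f (Set.Iio n) Set.univ ∧ IsStable m n (t ∘ f) := by
  obtain ⟨g, hg, hgA⟩ := exists_injective_of_le_ncard hA
  obtain ⟨g', hg', hgB⟩ := exists_injective_of_le_ncard hB
  have hne : ∀ i j, g i ≠ g' j := fun i j h => hAB (by rw [← hgA i, h, hgB])
  have hg01 : g 0 ≠ g 1 := fun h => by simpa using hg h
  have hg'01 : g' 0 ≠ g' 1 := fun h => by simpa using hg' h
  obtain ⟨f, hf, hfp⟩ := exists_bijOn_extending hn (p := ![0, n - 2, 1, n - 1])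
    (by intro i j h; fin_cases i <;> fin_cases j <;> simp at h ⊢ <;> omega)
    (by intro i; fin_cases i <;> simp <;> omega) (g := ![g 0, g 1, g' 0, g' 1])
    (by intro i j h
        fin_cases i <;> fin_cases j <;>
          simp [hne, (hne _ _).symm, hg01, hg01.symm, hg'01, hg'01.symm] at h ⊢)
  have f0 : f 0 = g 0 := hfp 0
  have f1 : f (n - 2) = g 1 := hfp 1
  have f2 : f 1 = g' 0 := hfp 2
  have f3 : f (n - 1) = g' 1 := hfp 3
  exact ⟨f, hf, isStable_of_even_two_types hn4 heven hAB
    (by rw [Function.comp_apply, f0, hgA]) (by rw [Function.comp_apply, f2, hgB])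
    (by rw [Function.comp_apply, f1, hgA]) (by rw [Function.comp_apply, f3, hgB])
    (seesOther_of_ncard_type_le_three hf h3)⟩

theorem exists_isStable_of_even_of_one_type [Nonempty N] (hn : Fintype.card N = n) (heven : n % 2 = 0)
    (A : T) (h1 : ∀ X, X ≠ A → {i | t i = X}.ncard ≤ 1)
    (hA : {i | t i = A}.ncard = 2 ∨ {i | t i = A}.ncard = 3)
    (hnA : {i | t i = A}.ncard + 2 ≤ n) :
    ∃ f : ℕ → N, Set.BijOn f (Set.Iio n) Set.univ ∧ IsStable m n (t ∘ f) := by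
  have single : ∀ f : ℕ → N, Set.BijOn f (Set.Iio n) Set.univ → ∀ a < n, ∀ b < n,
      (t ∘ f) a ≠ A → (t ∘ f) a = (t ∘ f) b → a = b := by
    intro f hf a ha b hb haA hab
    by_contra hne
    have h2 := card_le_ncard_type (t := t) hf ((t ∘ f) a) {a, b} (by
      simp only [Finset.mem_insert, Finset.mem_singleton]
      rintro c (rfl | rfl)
      exacts [⟨ha, rfl⟩, ⟨hb, hab.symm⟩])
    rw [Finset.card_pair hne] at h2
    have := h1 _ haA
    omega
  rcases hA with hA | hA
  · obtain ⟨g, hg, hgA⟩ := exists_injective_of_le_ncard hA.ge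
    obtain ⟨f, hf, hfp⟩ := exists_bijOn_extending hn (p := ![n - 2, n - 1])
      (by intro i j h; fin_cases i <;> fin_cases j <;> simp at h ⊢ <;> omega)
      (by intro i; fin_cases i <;> simp <;> omega) hg
    have f1 : (t ∘ f) (n - 2) = A := by
      rw [Function.comp_apply, show f (n - 2) = g 0 from hfp 0, hgA]
    have f2 : (t ∘ f) (n - 1) = A := by
      rw [Function.comp_apply, show f (n - 1) = g 1 from hfp 1, hgA]
    refine ⟨f, hf, isStable_of_even_one_type (by omega) heven A False False.elim f1 f2
      (fun a ha haA => ?_) (single f hf)⟩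
    by_contra hcon
    have h4 := card_le_ncard_type (t := t) hf A {n - 2, n - 1, a} (by
      simp only [Finset.mem_insert, Finset.mem_singleton]
      rintro b (rfl | rfl | rfl)
      exacts [⟨by omega, f1⟩, ⟨by omega, f2⟩, ⟨ha, haA⟩])
    rw [Finset.card_insert_of_notMem, Finset.card_insert_of_notMem, Finset.card_singleton] at h4
    · omega
    all_goals simp only [Finset.mem_insert, Finset.mem_singleton]; omega
  · obtain ⟨g, hg, hgA⟩ := exists_injective_of_le_ncard hA.ge
    obtain ⟨f, hf, hfp⟩ := exists_bijOn_extending hn (p := ![0, n - 2, n - 1])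
      (by intro i j h; fin_cases i <;> fin_cases j <;> simp at h ⊢ <;> omega)
      (by intro i; fin_cases i <;> simp <;> omega) hg
    have f0 : (t ∘ f) 0 = A := by rw [Function.comp_apply, show f 0 = g 0 from hfp 0, hgA]
    have f1 : (t ∘ f) (n - 2) = A := by
      rw [Function.comp_apply, show f (n - 2) = g 1 from hfp 1, hgA]
    have f2 : (t ∘ f) (n - 1) = A := by
      rw [Function.comp_apply, show f (n - 1) = g 2 from hfp 2, hgA]
    refine ⟨f, hf, isStable_of_even_one_type (by omega) heven A True
      (fun _ => ⟨by omega, f0⟩) f1 f2 (fun a ha haA => ?_) (single f hf)⟩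
    rw [and_true]
    by_contra hcon
    have h4 := card_le_ncard_type (t := t) hf A {0, n - 2, n - 1, a} (by
      simp only [Finset.mem_insert, Finset.mem_singleton]
      rintro b (rfl | rfl | rfl | rfl)
      exacts [⟨by omega, f0⟩, ⟨by omega, f1⟩, ⟨by omega, f2⟩, ⟨ha, haA⟩])
    rw [Finset.card_insert_of_notMem, Finset.card_insert_of_notMem,
      Finset.card_insert_of_notMem, Finset.card_singleton] at h4
    · omega
    all_goals simp only [Finset.mem_insert, Finset.mem_singleton]; omega

end Cases

end VarietyJumpGame

open VarietyJumpGame in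
theorem theorem7 {N T : Type*} [Fintype N] [Fintype T] (m : ℕ)
    (t : N → T) (ht : Function.Surjective t)
    (hn : 2 ≤ Fintype.card N) (hk : 2 ≤ Fintype.card T)
    (hV : Fintype.card N < 2 * m) :
    ∃ v : N → Fin 2 × Fin m,
      VarietyJumpGame.IsEquilibrium (VarietyJumpGame.cylinderGraph m) t v := by
  classical
  have hcard : Fintype.card N ≤ Fintype.card (Fin 2 × Fin m) := by
    rw [Fintype.card_prod, Fintype.card_fin, Fintype.card_fin]
    exact hV.le
  by_cases hT : Fintype.card T = 2
  · exact exists_isEquilibrium_of_card_eq_two _ t hT hcard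
  have hT3 : 3 ≤ Fintype.card T := by omega
  by_cases hinj : Function.Injective t
  · exact exists_isEquilibrium_of_injective _ t hinj hcard
  have : Nonempty N := Fintype.card_pos_iff.1 (by omega)
  have : Nonempty T := Fintype.card_pos_iff.1 (by omega)
  obtain ⟨A, hmax⟩ := Finite.exists_max fun X => {i | t i = X}.ncard
  have hpos : ∀ X, 1 ≤ {i | t i = X}.ncard := fun X =>
    let ⟨i, hi⟩ := ht X
    (Set.ncard_pos (Set.toFinite _)).2 ⟨i, hi⟩
  have hA2 : 2 ≤ {i | t i = A}.ncard := by
    rw [Function.Injective] at hinj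
    push Not at hinj
    obtain ⟨i, j, hij, hne⟩ := hinj
    refine le_trans ?_ (hmax (t i))
    exact (Set.one_lt_ncard (Set.toFinite _)).2 ⟨i, rfl, j, hij.symm, hne⟩
  obtain ⟨B, hBA⟩ : ∃ B, B ≠ A := by
    have : Nontrivial T := Fintype.one_lt_card_iff_nontrivial.1 (by omega)
    exact exists_ne A
  have hAn : {i | t i = A}.ncard + 2 ≤ Fintype.card N := by
    have h1 := ncard_type_add_ncard_type_lt ht hT3 hBA
    have h2 := hpos B
    omega
  suffices h : ∃ f : ℕ → N, Set.BijOn f (Set.Iio (Fintype.card N)) Set.univ ∧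
      IsStable m (Fintype.card N) (t ∘ f) by
    obtain ⟨f, hf, hstable⟩ := h
    exact exists_isEquilibrium_of_isStable (by omega) hV.le t hf hstable
  by_cases hA4 : 4 ≤ {i | t i = A}.ncard
  · exact exists_isStable_of_four_le rfl ht hT3 A hmax hA4 (by omega)
  have h3 : ∀ X, {i | t i = X}.ncard ≤ 3 := fun X => (hmax X).trans (by omega)
  rcases Nat.mod_two_eq_zero_or_one (Fintype.card N) with heven | hodd
  · by_cases hB : ∃ B, A ≠ B ∧ 2 ≤ {i | t i = B}.ncard
    · obtain ⟨B, hAB, hB⟩ := hB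
      exact exists_isStable_of_even_of_two_types rfl heven (by omega) hAB h3 hA2 hB
    · push Not at hB
      exact exists_isStable_of_even_of_one_type rfl heven A
        (fun X hX => Nat.le_of_lt_succ (hB X hX.symm)) (by omega) hAn
  · by_cases hA3 : 3 ≤ {i | t i = A}.ncard
    · exact exists_isStable_of_odd_of_three rfl hodd (by omega) hV A h3 hA3
    · exact exists_isStable_of_odd_of_two rfl hodd (by omega) A
        (fun X => (hmax X).trans (by omega)) hA2
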